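/- Let $\Sigma$ be a finite alphabet. A \emph{pomset} over $\Sigma$ is an isomorphism class of finite posets whose points are labelled by elements of $\Sigma$; $1$ denotes the empty pomset, and $a\in\Sigma$ also denotes the one-point pomset labelled $a$. For pomsets $U,V$, the parallel composition $U\parallel V$ is their disjoint union (with no order between $U$ and $V$), and the sequential composition $U\cdot V$ is their disjoint union with in addition every point of $U$ below every point of $V$. The \emph{series-rational expressions} are given by the grammar $$e,f ::= 0 \mid 1 \mid a\in\Sigma \mid e+f \mid e\cdot f \mid e\parallel f \mid e^*,$$ and $\llbracket e\rrbracket$ is the set of pomsets defined by $\llbracket 0\rrbracket=\emptyset$, $\llbracket 1\rrbracket=\{1\}$, $\llbracket a\rrbracket=\{a\}$, $\llbracket e+f\rrbracket=\llbracket e\rrbracket\cup\llbracket f\rrbracket$, $\llbracket e\cdot f\rrbracket=\{U\cdot V: U\in\llbracket e\rrbracket, V\in\llbracket f\rrbracket\}$, $\llbracket e\parallel f\rrbracket=\{U\parallel V: U\in\llbracket e\rrbracket, V\in\llbracket f\rrbracket\}$, and $\llbracket e^*\rrbracket=\{U_1\cdots U_n: n\ge 0,\ U_1,\dots,U_n\in\llbracket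 e\rrbracket\}$. A \emph{pomset automaton} (PA) $A=\langle Q,\delta,\gamma,F\rangle$ consists of a set $Q$ of states, functions $\delta:Q\times\Sigma\to Q$ and $\gamma:Q\times\binom{Q}{2}\to Q$, where $\binom{Q}{2}$ is the set of two-element multisets over $Q$, and a set $F\subseteq Q$ of accepting states. Its trace relation $q\xrightarrow{U}q'$ (with $q,q'\in Q$ and $U$ a non-empty pomset) is the smallest relation such that (i) $q\xrightarrow{a}\delta(q,a)$ for all $q\in Q$ and $a\in\Sigma$; (ii) if $q\xrightarrow{U}q''$ and $q''\xrightarrow{V}q'$, then $q\xrightarrow{U\cdot V}q'$; (iii) if $r\xrightarrow{U}r'\in F$ and $s\xrightarrow{V}s'\in F$, then $q\xrightarrow{U\parallel V}\gamma(q,\{\!|r,s|\!\})$ for every $q\in Q$. The language of $A$ at $q$ is $$L_A(q)=\{U: \exists q'\in F.\ q\xrightarrow{U}q'\}\cup\{1: q\in F\}.$$ The automaton $A$ \emph{accepts} a set $\mathcal U$ of pomsets if $L_A(q)=\mathcal U$ for some $q\in Q$. A \emph{sink} of $A$ is a state $\bot\in Q\setminus F$ with $\delta(\bot,a)=\bot$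 for all $a\in\Sigma$ and $\gamma(\bot,\phi)=\bot$ for all $\phi\in\binom{Q}{2}$. \textbf{Theorem.} For every series-rational expression $e$ over $\Sigma$ there exists a pomset automaton $A_e$ with finitely many states, among them a sink, that accepts $\llbracket e\rrbracket$. -/

import Mathlib

/-- A labelled poset over the alphabet `α` (with finite carrier, as are all pomsets considered):
a carrier, a partial order on it, and a labelling of the carrier by letters. -/
structure LabelledPoset (α : Type*) where
  carrier : Type
  [order : PartialOrder carrier]
  [finite : Finite carrier]
  label : carrier → α

attribute [instance] LabelledPoset.order LabelledPoset.finite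

namespace LabelledPoset

/-- Two labelled posets are isomorphic if there is an order isomorphism between
their carriers that preserves the labels. -/
def Iso {α : Type*} (U V : LabelledPoset α) : Prop :=
  ∃ f : U.carrier ≃o V.carrier, ∀ u, V.label (f u) = U.label u

theorem iso_equivalence (α : Type*) : Equivalence (Iso (α := α)) where
  refl U := ⟨OrderIso.refl _, fun _ => rfl⟩
  symm := by
    rintro U V ⟨f, hf⟩
    exact ⟨f.symm, fun v => by rw [← hf, f.apply_symm_apply]⟩
  trans := by
    rintro U V W ⟨f, hf⟩ ⟨g, hg⟩
    exact ⟨f.trans g, fun u => by simp [hg, hf]⟩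

instance setoid (α : Type*) : Setoid (LabelledPoset α) := ⟨Iso, iso_equivalence α⟩

/-- The labelled poset with empty carrier. -/
def empty (α : Type*) : LabelledPoset α where
  carrier := Empty
  label := Empty.elim

/-- The labelled poset with exactly one point, labelled `a`. -/
def single {α : Type*} (a : α) : LabelledPoset α where
  carrier := Unit
  label := fun _ => a

/-- Sequential composition: the disjoint union of the carriers, in which, besides the two given
orders, every point of `U` lies below every point of `V`. -/
def seq {α : Type*} (U V : LabelledPoset α) : LabelledPoset α where
  carrier := U.carrier ⊕ₗ V.carrier
  finite := inferInstanceAs (Finite (U.carrier ⊕ V.carrier))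
  label := fun x => Sum.elim U.label V.label (ofLex x)

/-- Parallel composition: the disjoint union of the two ordered sets. -/
def par {α : Type*} (U V : LabelledPoset α) : LabelledPoset α where
  carrier := U.carrier ⊕ V.carrier
  label := Sum.elim U.label V.label

end LabelledPoset

/-- A pomset over `α` is an isomorphism class of labelled posets over `α`. -/
def Pom (α : Type*) := Quotient (LabelledPoset.setoid α)

namespace Pom

/-- The empty pomset `1`. -/
def one (α : Type*) : Pom α := Quotient.mk _ (LabelledPoset.empty α)

/-- The primitive pomset of the letter `a`. -/
def prim {α : Type*} (a : α) : Pom α := Quotient.mk _ (LabelledPoset.single a)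

/-- Sequential composition of pomsets. -/
def seq {α : Type*} : Pom α → Pom α → Pom α :=
  Quotient.map₂ LabelledPoset.seq (by
    rintro U U' ⟨f, hf⟩ V V' ⟨g, hg⟩
    refine ⟨OrderIso.sumLexCongr f g, fun x => ?_⟩
    rcases x with x | x
    · exact hf x
    · exact hg x)

/-- Parallel composition of pomsets. -/
def par {α : Type*} : Pom α → Pom α → Pom α :=
  Quotient.map₂ LabelledPoset.par (by
    rintro U U' ⟨f, hf⟩ V V' ⟨g, hg⟩
    refine ⟨OrderIso.sumCongr f g, fun x => ?_⟩
    rcases x with x | x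
    · exact hf x
    · exact hg x)

end Pom

/-- A pomset language over `α` is a set of pomsets over `α`. -/
abbrev PomLang (α : Type*) := Set (Pom α)

namespace PomLang

def seq {α : Type*} (L M : PomLang α) : PomLang α :=
  {W | ∃ U ∈ L, ∃ V ∈ M, W = Pom.seq U V}

def par {α : Type*} (L M : PomLang α) : PomLang α :=
  {W | ∃ U ∈ L, ∃ V ∈ M, W = Pom.par U V}

def pow {α : Type*} (L : PomLang α) : ℕ → PomLang α
  | 0 => {Pom.one α}
  | n + 1 => seq L (pow L n)

/-- The Kleene closure of a pomset language. -/
def star {α : Type*} (L : PomLang α) : PomLang α := ⋃ n : ℕ, pow L n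

end PomLang

/-- Series-rational expressions over the alphabet `α`. -/
inductive SRExpr (α : Type*) where
  | zero : SRExpr α
  | one : SRExpr α
  | letter (a : α) : SRExpr α
  | plus (e f : SRExpr α) : SRExpr α
  | seq (e f : SRExpr α) : SRExpr α
  | par (e f : SRExpr α) : SRExpr α
  | star (e : SRExpr α) : SRExpr α

/-- The pomset language denoted by a series-rational expression. -/
def SRExpr.sem {α : Type*} : SRExpr α → PomLang α
  | .zero => ∅
  | .one => {Pom.one α}
  | .letter a => {Pom.prim a}
  | .plus e f => e.sem ∪ f.sem
  | .seq e f => PomLang.seq e.sem f.sem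
  | .par e f => PomLang.par e.sem f.sem
  | .star e => PomLang.star e.sem

/-- A pomset automaton over the alphabet `α` with set of states `Q`: a sequential transition
function, a parallel transition function (whose second argument is a multiset of states of
size two) and a set of accepting states. -/
structure PomsetAutomaton (α : Type*) (Q : Type*) where
  δ : Q → α → Q
  γ : Q → Sym2 Q → Q
  F : Set Q

namespace PomsetAutomaton

/-- `A.Trace q U q'`: the least relation closed under the three rules. The label `U` of a trace is
a non-empty pomset, since that of `letter` is, and the compositions of non-empty pomsets are. -/
inductive Trace {α Q : Type*} (A : PomsetAutomaton α Q) : Q → Pom α → Q → Prop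
  | letter (q : Q) (a : α) : Trace A q (Pom.prim a) (A.δ q a)
  | seq {q q'' q' : Q} {U V : Pom α} :
      Trace A q U q'' → Trace A q'' V q' → Trace A q (Pom.seq U V) q'
  | par (q : Q) {r r' s s' : Q} {U V : Pom α} :
      Trace A r U r' → r' ∈ A.F → Trace A s V s' → s' ∈ A.F →
      Trace A q (Pom.par U V) (A.γ q s(r, s))

/-- The trace relation extended by empty traces from each state to itself. -/
def ReflTrace {α Q : Type*} (A : PomsetAutomaton α Q) (q : Q) (U : Pom α) (q' : Q) : Prop :=
  (q' = q ∧ U = Pom.one α) ∨ A.Trace q U q'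

/-- The language of the automaton `A` at the state `q`. -/
def lang {α Q : Type*} (A : PomsetAutomaton α Q) (q : Q) : PomLang α :=
  {U | ∃ q' ∈ A.F, A.ReflTrace q U q'}

/-- `A` accepts the language `L` if `L` is the language of `A` at some state. -/
def Accepts {α Q : Type*} (A : PomsetAutomaton α Q) (L : PomLang α) : Prop :=
  ∃ q : Q, A.lang q = L

/-- A sink state: a non-accepting state that all transitions from it lead back to. -/
def IsSink {α Q : Type*} (A : PomsetAutomaton α Q) (b : Q) : Prop :=
  b ∉ A.F ∧ (∀ a : α, A.δ b a = b) ∧ ∀ φ : Sym2 Q, A.γ b φ = b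

end PomsetAutomaton

/-! The argument is in the spirit of partial derivatives: states are languages and transitions are
residuals. By induction on `e`, the language `e.sem` lies in a finite family `𝓠` such that every
non-empty pomset of any `L ∈ 𝓠` belongs to some product `H · K ⊆ L`, with `K ∈ 𝓠` and `H` a letter
or a fork of two members of `𝓠` (`SRExpr.finitelyDecomposable_sem`).

Closing `𝓠` under unions keeps it finite and yields, for all `H` and `L`, a largest `K ∈ 𝓠` with `H
· K ⊆ L` (`PomLang.exists_largest_residual`). This choice is a function, so it defines `δ` and `γ`;
the empty language becomes the sink. The inclusion `H · K ⊆ L` makes traces sound; maximality lets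
every decomposition be followed by a transition, so completeness follows by induction on the number
of points (`PomsetAutomaton.lang_eq`). -/

namespace Pom

variable {α : Type*}

/-- The number of points of a pomset. -/
noncomputable def size : Pom α → ℕ :=
  Quotient.lift (fun U : LabelledPoset α => Nat.card U.carrier) (by
    rintro U V ⟨f, -⟩
    exact Nat.card_congr f.toEquiv)

theorem size_one : size (one α) = 0 := by
  change Nat.card Empty = 0
  simp

theorem size_prim (a : α) : size (prim a) = 1 := by
  change Nat.card Unit = 1
  simp

theorem size_seq (U V : Pom α) : size (seq U V) = size U + size V := by
  induction U, V using Quotient.inductionOn₂ with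
  | h U V => exact Nat.card_sum (α := U.carrier) (β := V.carrier)

theorem size_par (U V : Pom α) : size (par U V) = size U + size V := by
  induction U, V using Quotient.inductionOn₂ with
  | h U V => exact Nat.card_sum (α := U.carrier) (β := V.carrier)

theorem size_eq_zero {U : Pom α} : size U = 0 ↔ U = one α := by
  refine ⟨?_, fun h => h ▸ size_one⟩
  induction U using Quotient.inductionOn with
  | h U =>
    intro h
    have : IsEmpty U.carrier := (Finite.card_eq_zero_iff (α := U.carrier)).1 h
    exact Quotient.sound ⟨{ toEquiv := Equiv.equivOfIsEmpty U.carrier Empty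
                            map_rel_iff' := fun {x} => isEmptyElim x }, fun x => isEmptyElim x⟩

theorem one_seq (U : Pom α) : seq (one α) U = U := by
  induction U using Quotient.inductionOn with
  | h U =>
    refine Quotient.sound ⟨OrderIso.emptySumLex (α := U.carrier) (β := Empty), ?_⟩
    rintro (x | x)
    · exact x.elim
    · rfl

theorem seq_one (U : Pom α) : seq U (one α) = U := by
  induction U using Quotient.inductionOn with
  | h U =>
    refine Quotient.sound ⟨OrderIso.sumLexEmpty (α := U.carrier) (β := Empty), ?_⟩
    rintro (x | x)
    · rfl
    · exact x.elim

theorem seq_assoc (U V W : Pom α) : seq (seq U V) W = seq U (seq V W) := by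
  induction U, V, W using Quotient.inductionOn₃ with
  | h U V W =>
    refine Quotient.sound ⟨OrderIso.sumLexAssoc U.carrier V.carrier W.carrier, ?_⟩
    rintro ((x | x) | x) <;> rfl

theorem par_comm (U V : Pom α) : par U V = par V U := by
  induction U, V using Quotient.inductionOn₂ with
  | h U V =>
    refine Quotient.sound ⟨OrderIso.sumComm U.carrier V.carrier, ?_⟩
    rintro (x | x) <;> rfl

theorem par_one (U : Pom α) : par U (one α) = U := by
  induction U using Quotient.inductionOn with
  | h U =>
    refine Quotient.sound ⟨{ toEquiv := Equiv.sumEmpty U.carrier Empty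
                             map_rel_iff' := ?_ }, ?_⟩
    · rintro (x | x) (y | y)
      · exact Sum.inl_le_inl_iff.symm
      all_goals first | exact x.elim | exact y.elim
    · rintro (x | x)
      · rfl
      · exact x.elim

theorem one_par (U : Pom α) : par (one α) U = U := by
  rw [par_comm, par_one]

end Pom

/-! ### Algebra of pomset languages. -/

namespace PomLang

variable {α : Type*}

/-- The non-empty pomsets of a language. -/
def pos (L : PomLang α) : PomLang α := L \ {Pom.one α}

theorem seq_mono {L L' M M' : PomLang α} (hL : L ⊆ L') (hM : M ⊆ M') : seq L M ⊆ seq L' M' := by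
  rintro _ ⟨U, hU, V, hV, rfl⟩
  exact ⟨U, hL hU, V, hM hV, rfl⟩

theorem seq_assoc (L M N : PomLang α) : seq (seq L M) N = seq L (seq M N) := by
  ext W
  constructor
  · rintro ⟨_, ⟨U, hU, V, hV, rfl⟩, X, hX, rfl⟩
    exact ⟨U, hU, _, ⟨V, hV, X, hX, rfl⟩, Pom.seq_assoc U V X⟩
  · rintro ⟨U, hU, _, ⟨V, hV, X, hX, rfl⟩, rfl⟩
    exact ⟨_, ⟨U, hU, V, hV, rfl⟩, X, hX, (Pom.seq_assoc U V X).symm⟩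

theorem seq_one (L : PomLang α) : seq L {Pom.one α} = L := by
  ext W
  constructor
  · rintro ⟨U, hU, _, rfl, rfl⟩
    rwa [Pom.seq_one]
  · exact fun hW => ⟨W, hW, _, rfl, (Pom.seq_one W).symm⟩

theorem par_comm (L M : PomLang α) : par L M = par M L := by
  ext W
  constructor <;> rintro ⟨U, hU, V, hV, rfl⟩ <;> exact ⟨V, hV, U, hU, Pom.par_comm U V⟩

theorem subset_seq_of_one_mem {L : PomLang α} (h : Pom.one α ∈ L) (M : PomLang α) :
    M ⊆ seq L M := fun W hW => ⟨_, h, W, hW, (Pom.one_seq W).symm⟩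

theorem subset_par_of_one_mem {L : PomLang α} (h : Pom.one α ∈ L) (M : PomLang α) :
    M ⊆ par L M := fun W hW => ⟨_, h, W, hW, (Pom.one_par W).symm⟩

theorem one_mem_star (L : PomLang α) : Pom.one α ∈ star L := Set.mem_iUnion.2 ⟨0, rfl⟩

theorem seq_star_subset (L : PomLang α) : seq L (star L) ⊆ star L := by
  rintro _ ⟨U, hU, V, hV, rfl⟩
  obtain ⟨n, hn⟩ := Set.mem_iUnion.1 hV
  exact Set.mem_iUnion.2 ⟨n + 1, U, hU, V, hn, rfl⟩

/-- Leading empty factors can be dropped until a non-empty one comes first. -/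
theorem exists_pos_of_mem_star {L : PomLang α} {W : Pom α} (hW : W ∈ star L)
    (h1 : W ≠ Pom.one α) : W ∈ seq (pos L) (star L) := by
  obtain ⟨n, hn⟩ := Set.mem_iUnion.1 hW
  clear hW
  induction n generalizing W with
  | zero => exact absurd hn h1
  | succ n ih =>
    obtain ⟨U, hU, V, hV, rfl⟩ := hn
    by_cases hU1 : U = Pom.one α
    · rw [hU1, Pom.one_seq] at h1 ⊢
      exact ih h1 hV
    · exact ⟨U, ⟨hU, hU1⟩, V, Set.mem_iUnion.2 ⟨n, hV⟩, rfl⟩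

/-! ### Heads and decompositions. -/

/-- `IsHead 𝓠 H`: the language `H` is a single letter, or consists of the parallel compositions of
non-empty pomsets from two members of `𝓠`. -/
inductive IsHead (𝓠 : Set (PomLang α)) : PomLang α → Prop
  | letter (a : α) : IsHead 𝓠 {Pom.prim a}
  | fork {M N : PomLang α} : M ∈ 𝓠 → N ∈ 𝓠 → IsHead 𝓠 (par (pos M) (pos N))

theorem IsHead.mono {𝓠 𝓡 : Set (PomLang α)} (h : 𝓠 ⊆ 𝓡) {H : PomLang α} (hH : IsHead 𝓠 H) :
    IsHead 𝓡 H := by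
  cases hH with
  | letter a => exact .letter a
  | fork hM hN => exact .fork (h hM) (h hN)

/-- Every non-empty pomset of `L` lies in some `seq H K ⊆ L`, where `H` is a head over `𝓠`
and `K ∈ 𝓠`. -/
def Decomposes (𝓠 : Set (PomLang α)) (L : PomLang α) : Prop :=
  ∀ W ∈ pos L, ∃ H K, IsHead 𝓠 H ∧ K ∈ 𝓠 ∧ W ∈ seq H K ∧ seq H K ⊆ L

theorem Decomposes.mono {𝓠 𝓡 : Set (PomLang α)} (h : 𝓠 ⊆ 𝓡) {L : PomLang α}
    (hL : Decomposes 𝓠 L) : Decomposes 𝓡 L := fun W hW =>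
  let ⟨H, K, hH, hK, hW⟩ := hL W hW
  ⟨H, K, hH.mono h, h hK, hW⟩

theorem Decomposes.sUnion {𝓠 S : Set (PomLang α)} (h : ∀ L ∈ S, Decomposes 𝓠 L) :
    Decomposes 𝓠 (⋃₀ S) := by
  rintro W ⟨⟨L, hL, hW⟩, h1⟩
  obtain ⟨H, K, hH, hK, hWK, hsub⟩ := h L hL W ⟨hW, h1⟩
  exact ⟨H, K, hH, hK, hWK, hsub.trans (Set.subset_sUnion_of_mem hL)⟩

theorem decomposes_one (𝓠 : Set (PomLang α)) : Decomposes 𝓠 {Pom.one α} :=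
  fun _ hW => absurd hW.1 hW.2

/-- The pomsets of `seq K M` that have a non-empty prefix in `K` decompose as that prefix does. -/
theorem exists_head_of_mem_seq_pos {𝓠 𝓡 : Set (PomLang α)} (h𝓠 : 𝓠 ⊆ 𝓡) {K M : PomLang α}
    (hK : Decomposes 𝓠 K) (h𝓡 : ∀ K' ∈ 𝓠, seq K' M ∈ 𝓡) {W : Pom α} (hW : W ∈ seq (pos K) M) :
    ∃ H K', IsHead 𝓡 H ∧ K' ∈ 𝓡 ∧ W ∈ seq H K' ∧ seq H K' ⊆ seq K M := by
  obtain ⟨X, hX, Y, hY, rfl⟩ := hW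
  obtain ⟨H, K', hH, hK', hXK, hsub⟩ := hK X hX
  refine ⟨H, seq K' M, hH.mono h𝓠, h𝓡 K' hK', ?_, ?_⟩ <;> rw [← seq_assoc]
  · exact ⟨X, hXK, Y, hY, rfl⟩
  · exact seq_mono hsub subset_rfl

theorem Decomposes.seq {𝓠 𝓡 : Set (PomLang α)} (h𝓠 : 𝓠 ⊆ 𝓡) {K M : PomLang α}
    (hK : Decomposes 𝓠 K) (h𝓡 : ∀ K' ∈ 𝓠, PomLang.seq K' M ∈ 𝓡) (hM : Decomposes 𝓡 M) :
    Decomposes 𝓡 (PomLang.seq K M) := by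
  rintro _ ⟨⟨X, hX, Y, hY, rfl⟩, h1⟩
  by_cases hX1 : X = Pom.one α
  · subst hX1
    rw [Pom.one_seq] at h1 ⊢
    obtain ⟨H, K', hH, hK', hYK, hsub⟩ := hM Y ⟨hY, h1⟩
    exact ⟨H, K', hH, hK', hYK, hsub.trans (subset_seq_of_one_mem hX M)⟩
  · exact exists_head_of_mem_seq_pos h𝓠 hK h𝓡 ⟨X, ⟨hX, hX1⟩, Y, hY, rfl⟩

theorem Decomposes.star {𝓠 𝓡 : Set (PomLang α)} (h𝓠 : 𝓠 ⊆ 𝓡) {L : PomLang α}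
    (hL : Decomposes 𝓠 L) (h𝓡 : ∀ K ∈ 𝓠, PomLang.seq K (star L) ∈ 𝓡) :
    Decomposes 𝓡 (PomLang.star L) := by
  rintro W ⟨hW, h1⟩
  obtain ⟨H, K, hH, hK, hWK, hsub⟩ :=
    exists_head_of_mem_seq_pos h𝓠 hL h𝓡 (exists_pos_of_mem_star hW h1)
  exact ⟨H, K, hH, hK, hWK, hsub.trans (seq_star_subset L)⟩

/-- If both components are non-empty, the composition is itself in a head, with remainder `1`;
otherwise it reduces to one component, whose own decomposition serves. -/
theorem Decomposes.par {𝓠 : Set (PomLang α)} {L M : PomLang α} (hL : Decomposes 𝓠 L)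
    (hM : Decomposes 𝓠 M) (hL' : L ∈ 𝓠) (hM' : M ∈ 𝓠) (h1' : {Pom.one α} ∈ 𝓠) :
    Decomposes 𝓠 (PomLang.par L M) := by
  rintro _ ⟨⟨X, hX, Y, hY, rfl⟩, h1⟩
  by_cases hX1 : X = Pom.one α
  · subst hX1
    rw [Pom.one_par] at h1 ⊢
    obtain ⟨H, K, hH, hK, hYK, hsub⟩ := hM Y ⟨hY, h1⟩
    exact ⟨H, K, hH, hK, hYK, hsub.trans (subset_par_of_one_mem hX M)⟩
  by_cases hY1 : Y = Pom.one α
  · subst hY1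
    rw [Pom.par_one] at h1 ⊢
    obtain ⟨H, K, hH, hK, hXK, hsub⟩ := hL X ⟨hX, h1⟩
    rw [par_comm]
    exact ⟨H, K, hH, hK, hXK, hsub.trans (subset_par_of_one_mem hY L)⟩
  refine ⟨_, _, .fork hL' hM', h1', ?_⟩
  rw [seq_one]
  refine ⟨⟨X, ⟨hX, hX1⟩, Y, ⟨hY, hY1⟩, rfl⟩, ?_⟩
  rintro _ ⟨U, hU, V, hV, rfl⟩
  exact ⟨U, hU.1, V, hV.1, rfl⟩

/-! ### Finite decomposability under the series-rational operations. -/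

/-- `L` belongs to a finite set of languages each of which decomposes over that set. -/
def FinitelyDecomposable (L : PomLang α) : Prop :=
  ∃ 𝓠 : Set (PomLang α), 𝓠.Finite ∧ L ∈ 𝓠 ∧ ∀ M ∈ 𝓠, Decomposes 𝓠 M

theorem FinitelyDecomposable.exists_common {L M : PomLang α} (hL : FinitelyDecomposable L)
    (hM : FinitelyDecomposable M) : ∃ 𝓠 : Set (PomLang α), 𝓠.Finite ∧ L ∈ 𝓠 ∧ M ∈ 𝓠 ∧
      ∀ K ∈ 𝓠, Decomposes 𝓠 K := by
  obtain ⟨𝓠, hfin, hL, h⟩ := hL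
  obtain ⟨𝓡, hfin', hM, h'⟩ := hM
  refine ⟨𝓠 ∪ 𝓡, hfin.union hfin', .inl hL, .inr hM, ?_⟩
  rintro K (hK | hK)
  · exact (h K hK).mono Set.subset_union_left
  · exact (h' K hK).mono Set.subset_union_right

/-- Adding one language that decomposes over the enlarged set. -/
theorem finitelyDecomposable_of_insert {𝓠 : Set (PomLang α)} (hfin : 𝓠.Finite)
    (h : ∀ M ∈ 𝓠, Decomposes 𝓠 M) {L : PomLang α} (hL : Decomposes (insert L 𝓠) L) :
    FinitelyDecomposable L := by
  refine ⟨insert L 𝓠, hfin.insert L, Set.mem_insert L 𝓠, ?_⟩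
  rintro M (rfl | hM)
  · exact hL
  · exact (h M hM).mono (Set.subset_insert L 𝓠)

theorem finitelyDecomposable_empty : FinitelyDecomposable (∅ : PomLang α) :=
  ⟨{∅}, Set.finite_singleton ∅, rfl, fun _ hM _ hW => absurd hW.1 (hM ▸ Set.notMem_empty _)⟩

theorem finitelyDecomposable_one : FinitelyDecomposable ({Pom.one α} : PomLang α) :=
  ⟨{{Pom.one α}}, Set.finite_singleton _, rfl, by rintro _ rfl; exact decomposes_one _⟩

theorem finitelyDecomposable_prim (a : α) : FinitelyDecomposable ({Pom.prim a} : PomLang α) := by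
  refine finitelyDecomposable_of_insert (Set.finite_singleton {Pom.one α})
    (by rintro _ rfl; exact decomposes_one _) fun W hW => ?_
  refine ⟨_, _, .letter a, .inr rfl, ?_⟩
  rw [seq_one]
  exact ⟨hW.1, subset_rfl⟩

theorem FinitelyDecomposable.union {L M : PomLang α} (hL : FinitelyDecomposable L)
    (hM : FinitelyDecomposable M) : FinitelyDecomposable (L ∪ M) := by
  obtain ⟨𝓠, hfin, hL, hM, h⟩ := hL.exists_common hM
  refine finitelyDecomposable_of_insert hfin h (Decomposes.mono (Set.subset_insert _ 𝓠) ?_)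
  rw [← Set.sUnion_pair]
  refine Decomposes.sUnion ?_
  rintro K (rfl | rfl)
  · exact h _ hL
  · exact h _ hM

theorem FinitelyDecomposable.par {L M : PomLang α} (hL : FinitelyDecomposable L)
    (hM : FinitelyDecomposable M) : FinitelyDecomposable (PomLang.par L M) := by
  obtain ⟨𝓠, hfin, hL, hM, h⟩ := hL.exists_common hM
  have h' : ∀ K ∈ insert {Pom.one α} 𝓠, Decomposes (insert {Pom.one α} 𝓠) K := by
    rintro K (rfl | hK)
    · exact decomposes_one _
    · exact (h K hK).mono (Set.subset_insert _ 𝓠)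
  refine finitelyDecomposable_of_insert (hfin.insert {Pom.one α}) h'
    (Decomposes.mono (Set.subset_insert _ _) ?_)
  exact (h' L (.inr hL)).par (h' M (.inr hM)) (.inr hL) (.inr hM) (.inl rfl)

theorem FinitelyDecomposable.seq {L M : PomLang α} (hL : FinitelyDecomposable L)
    (hM : FinitelyDecomposable M) : FinitelyDecomposable (PomLang.seq L M) := by
  obtain ⟨𝓠, hfin, hL, hM, h⟩ := hL.exists_common hM
  refine ⟨𝓠 ∪ (PomLang.seq · M) '' 𝓠, hfin.union (hfin.image _), .inr ⟨L, hL, rfl⟩, ?_⟩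
  have h' : ∀ K ∈ 𝓠, Decomposes (𝓠 ∪ (PomLang.seq · M) '' 𝓠) K :=
    fun K hK => (h K hK).mono Set.subset_union_left
  rintro _ (hK | ⟨K, hK, rfl⟩)
  · exact h' _ hK
  · exact (h K hK).seq Set.subset_union_left (fun K' hK' => .inr ⟨K', hK', rfl⟩) (h' M hM)

theorem FinitelyDecomposable.star {L : PomLang α} (hL : FinitelyDecomposable L) :
    FinitelyDecomposable (PomLang.star L) := by
  obtain ⟨𝓠, hfin, hL, h⟩ := hL
  have hsub : 𝓠 ⊆ 𝓠 ∪ (PomLang.seq · (PomLang.star L)) '' 𝓠 := Set.subset_union_left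
  have hseq : ∀ K ∈ 𝓠, PomLang.seq K (PomLang.star L) ∈
      𝓠 ∪ (PomLang.seq · (PomLang.star L)) '' 𝓠 := fun K hK => .inr ⟨K, hK, rfl⟩
  have hstar := (h L hL).star hsub hseq
  -- The star is added separately, as it need not have the form `K · L*` with `K ∈ 𝓠`.
  have hins := Set.subset_insert (PomLang.star L) (𝓠 ∪ (PomLang.seq · (PomLang.star L)) '' 𝓠)
  refine ⟨_, (hfin.union (hfin.image (PomLang.seq · (PomLang.star L)))).insert (PomLang.star L),
    .inl rfl, ?_⟩
  rintro _ (rfl | hK | ⟨K, hK, rfl⟩)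
  · exact hstar.mono hins
  · exact (h _ hK).mono (hsub.trans hins)
  · exact ((h K hK).seq hsub hseq hstar).mono hins

/-- A finitely decomposable language belongs to a finite set as in the definition that is moreover
closed under unions. -/
theorem FinitelyDecomposable.exists_sUnion_closed {L : PomLang α} (hL : FinitelyDecomposable L) :
    ∃ 𝓠 : Set (PomLang α), 𝓠.Finite ∧ L ∈ 𝓠 ∧ (∀ M ∈ 𝓠, Decomposes 𝓠 M) ∧
      ∀ S ⊆ 𝓠, ⋃₀ S ∈ 𝓠 := by
  obtain ⟨𝓠, hfin, hL, h⟩ := hL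
  have hsub : 𝓠 ⊆ Set.sUnion '' 𝓠.powerset := fun K hK =>
    ⟨{K}, Set.singleton_subset_iff.2 hK, Set.sUnion_singleton K⟩
  refine ⟨Set.sUnion '' 𝓠.powerset, hfin.powerset.image _, hsub hL, ?_, fun S hS => ?_⟩
  · rintro _ ⟨S, hS, rfl⟩
    exact Decomposes.sUnion fun K hK => (h K (hS hK)).mono hsub
  -- Taking all generators inside `⋃₀ S` avoids choosing a family for each member of `S`.
  · refine ⟨{K ∈ 𝓠 | K ⊆ ⋃₀ S}, Set.sep_subset _ _, ?_⟩
    refine (Set.sUnion_subset fun K hK => hK.2).antisymm ?_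
    rintro W ⟨M, hM, hW⟩
    obtain ⟨T, hT, rfl⟩ := hS hM
    obtain ⟨K, hK, hWK⟩ := hW
    exact ⟨K, ⟨hT hK, (Set.subset_sUnion_of_mem hK).trans (Set.subset_sUnion_of_mem hM)⟩, hWK⟩

end PomLang

theorem SRExpr.finitelyDecomposable_sem {α : Type*} (e : SRExpr α) :
    e.sem.FinitelyDecomposable := by
  induction e with
  | zero => exact PomLang.finitelyDecomposable_empty
  | one => exact PomLang.finitelyDecomposable_one
  | letter a => exact PomLang.finitelyDecomposable_prim a
  | plus e f he hf => exact he.union hf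
  | seq e f he hf => exact he.seq hf
  | par e f he hf => exact he.par hf
  | star e he => exact he.star

/-! ### Soundness and completeness of residual automata. -/

namespace PomsetAutomaton

variable {α Q : Type*}

theorem Trace.trans_reflTrace {A : PomsetAutomaton α Q} {q r s : Q} {U V : Pom α}
    (hU : A.Trace q U r) (hV : A.ReflTrace r V s) : A.Trace q (Pom.seq U V) s := by
  rcases hV with ⟨rfl, rfl⟩ | hV
  · rwa [Pom.seq_one]
  · exact hU.seq hV

/-- If the transitions of `A` lead to residuals of the languages `D q`, then so do its traces. -/
theorem trace_sound {A : PomsetAutomaton α Q} {D : Q → PomLang α}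
    (hF : ∀ q, q ∈ A.F ↔ Pom.one α ∈ D q)
    (hδ : ∀ q a, PomLang.seq {Pom.prim a} (D (A.δ q a)) ⊆ D q)
    (hγ : ∀ q r s, PomLang.seq (PomLang.par (D r).pos (D s).pos) (D (A.γ q s(r, s))) ⊆ D q)
    {q q' : Q} {U : Pom α} (h : A.Trace q U q') :
    0 < U.size ∧ ∀ W ∈ D q', Pom.seq U W ∈ D q := by
  -- Positivity of the size is carried through the induction so that the two threads of a fork land
  -- in `pos`.
  have mem_pos : ∀ {r r' : Q} {X : Pom α}, r' ∈ A.F →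
      (0 < X.size ∧ ∀ W ∈ D r', Pom.seq X W ∈ D r) → X ∈ (D r).pos := fun {r r' X} hr' h => by
    refine ⟨Pom.seq_one X ▸ h.2 _ ((hF r').1 hr'), ?_⟩
    rintro rfl
    exact h.1.ne' Pom.size_one
  induction h with
  | letter q a =>
    exact ⟨by rw [Pom.size_prim]; exact one_pos, fun W hW => hδ q a ⟨_, rfl, W, hW, rfl⟩⟩
  | seq _ _ ih₁ ih₂ =>
    refine ⟨by rw [Pom.size_seq]; exact Nat.add_pos_left ih₁.1 _, fun W hW => ?_⟩
    rw [Pom.seq_assoc]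
    exact ih₁.2 _ (ih₂.2 W hW)
  | par q _ hr' _ hs' ih₁ ih₂ =>
    refine ⟨by rw [Pom.size_par]; exact Nat.add_pos_left ih₁.1 _, fun W hW => ?_⟩
    exact hγ q _ _ ⟨_, ⟨_, mem_pos hr' ih₁, _, mem_pos hs' ih₂, rfl⟩, W, hW, rfl⟩

/-- Strong induction on size: heads are non-empty, so the remainder is smaller; both threads of a
fork are non-empty, so each is smaller than the whole. -/
theorem mem_lang_of_mem {A : PomsetAutomaton α Q} {D : Q → PomLang α}
    (hF : ∀ q, q ∈ A.F ↔ Pom.one α ∈ D q)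
    (hD : ∀ q, ∀ W ∈ (D q).pos, (∃ a, W ∈ PomLang.seq {Pom.prim a} (D (A.δ q a))) ∨
      ∃ r s, W ∈ PomLang.seq (PomLang.par (D r).pos (D s).pos) (D (A.γ q s(r, s))))
    (W : Pom α) (q : Q) (hW : W ∈ D q) : W ∈ A.lang q := by
  induction hn : W.size using Nat.strong_induction_on generalizing W q with
  | _ n ih =>
    subst hn
    by_cases h1 : W = Pom.one α
    · exact ⟨q, (hF q).2 (h1 ▸ hW), .inl ⟨rfl, h1⟩⟩
    rcases hD q W ⟨hW, h1⟩ with ⟨a, _, rfl, V, hV, rfl⟩ | ⟨r, s, _, ⟨X, hX, Y, hY, rfl⟩, V, hV, rfl⟩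
    · obtain ⟨q', hq', ht⟩ := ih _ (by rw [Pom.size_seq, Pom.size_prim]; omega) V _ hV rfl
      exact ⟨q', hq', .inr (Trace.trans_reflTrace (.letter q a) ht)⟩
    · have hX0 : X.size ≠ 0 := fun h => hX.2 (Pom.size_eq_zero.1 h)
      have hY0 : Y.size ≠ 0 := fun h => hY.2 (Pom.size_eq_zero.1 h)
      simp only [Pom.size_seq, Pom.size_par] at ih
      obtain ⟨q', hq', ht⟩ := ih _ (by omega) V _ hV rfl
      obtain ⟨r', hr', htr⟩ := ih _ (by omega) X r hX.1 rfl
      obtain ⟨s', hs', hts⟩ := ih _ (by omega) Y s hY.1 rfl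
      have htr' := htr.resolve_left fun h => hX.2 h.2
      have hts' := hts.resolve_left fun h => hY.2 h.2
      exact ⟨q', hq', .inr (Trace.trans_reflTrace (.par q htr' hr' hts' hs') ht)⟩

theorem lang_eq {A : PomsetAutomaton α Q} {D : Q → PomLang α}
    (hF : ∀ q, q ∈ A.F ↔ Pom.one α ∈ D q)
    (hδ : ∀ q a, PomLang.seq {Pom.prim a} (D (A.δ q a)) ⊆ D q)
    (hγ : ∀ q r s, PomLang.seq (PomLang.par (D r).pos (D s).pos) (D (A.γ q s(r, s))) ⊆ D q)
    (hD : ∀ q, ∀ W ∈ (D q).pos, (∃ a, W ∈ PomLang.seq {Pom.prim a} (D (A.δ q a))) ∨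
      ∃ r s, W ∈ PomLang.seq (PomLang.par (D r).pos (D s).pos) (D (A.γ q s(r, s))))
    (q : Q) : A.lang q = D q := by
  refine Set.Subset.antisymm ?_ fun W hW => mem_lang_of_mem hF hD W q hW
  rintro U ⟨q', hq', ⟨rfl, rfl⟩ | ht⟩
  · exact (hF _).1 hq'
  · rw [← Pom.seq_one U]
    exact (trace_sound hF hδ hγ ht).2 _ ((hF q').1 hq')

end PomsetAutomaton

/-! ### The automaton of largest residuals. -/

/-- In a finite set of languages closed under unions there are largest residuals. -/
theorem PomLang.exists_largest_residual {α : Type*} {𝓠 : Set (PomLang α)}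
    (h𝓠 : ∀ S ⊆ 𝓠, ⋃₀ S ∈ 𝓠) (H L : PomLang α) :
    ∃ M ∈ 𝓠, PomLang.seq H M ⊆ L ∧ ∀ K ∈ 𝓠, PomLang.seq H K ⊆ L → K ⊆ M := by
  refine ⟨⋃₀ {K ∈ 𝓠 | PomLang.seq H K ⊆ L}, h𝓠 _ (Set.sep_subset _ _), ?_,
    fun K hK h => Set.subset_sUnion_of_mem (show K ∈ {K ∈ 𝓠 | PomLang.seq H K ⊆ L} from ⟨hK, h⟩)⟩
  rintro _ ⟨U, hU, V, ⟨K, hK, hV⟩, rfl⟩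
  exact hK.2 ⟨U, hU, V, hV, rfl⟩

open Classical in
theorem PomLang.FinitelyDecomposable.exists_automaton {α : Type*} {L : PomLang α}
    (hL : L.FinitelyDecomposable) :
    ∃ (Q : Type) (_ : Finite Q) (A : PomsetAutomaton α Q),
      (∃ b : Q, A.IsSink b) ∧ A.Accepts L := by
  obtain ⟨𝓠, hfin, hL, hdec, hU⟩ := hL.exists_sUnion_closed
  have := hfin.to_subtype
  -- States must live in `Type`, whereas `𝓠` lies in a higher universe.
  obtain ⟨n, ⟨i⟩⟩ := Finite.exists_equiv_fin 𝓠
  let D : Fin n → PomLang α := fun q => i.symm q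
  have hDmem (q) : D q ∈ 𝓠 := (i.symm q).2
  have hDsurj {K} (hK : K ∈ 𝓠) : ∃ q, D q = K := ⟨i ⟨K, hK⟩, by simp [D]⟩
  have hres (H M : PomLang α) : ∃ q, PomLang.seq H (D q) ⊆ M ∧
      ∀ K ∈ 𝓠, PomLang.seq H K ⊆ M → K ⊆ D q := by
    obtain ⟨M', hM', h⟩ := exists_largest_residual hU H M
    obtain ⟨q, rfl⟩ := hDsurj hM'
    exact ⟨q, h⟩
  choose res hsub hmax using hres
  let fork : Sym2 (Fin n) → PomLang α :=
    Sym2.lift ⟨fun r s => PomLang.par (D r).pos (D s).pos, fun r s => par_comm _ _⟩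
  -- The case `D q = ∅` is separate because a fork language may be empty: every `K` then satisfies
  -- `H · K ⊆ ∅`, and the largest residual would be all of `⋃₀ 𝓠`, not the sink.
  let A : PomsetAutomaton α (Fin n) :=
    { δ := fun q a => if D q = ∅ then q else res {Pom.prim a} (D q)
      γ := fun q φ => if D q = ∅ then q else res (fork φ) (D q)
      F := {q | Pom.one α ∈ D q} }
  have hempty (q) (hq : D q = ∅) (H : PomLang α) : PomLang.seq H (D q) ⊆ D q := by
    rintro _ ⟨U, -, V, hV, rfl⟩
    exact absurd hV (hq ▸ Set.notMem_empty V)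
  obtain ⟨b, hb⟩ := hDsurj (K := ∅) (Set.sUnion_empty ▸ hU ∅ (Set.empty_subset 𝓠))
  obtain ⟨q, rfl⟩ := hDsurj hL
  refine ⟨Fin n, inferInstance, A, ⟨b, fun h => Set.notMem_empty _ (hb.subset h), fun a => if_pos hb,
    fun φ => if_pos hb⟩, q, ?_⟩
  refine PomsetAutomaton.lang_eq (fun q => Iff.rfl) (fun q a => ?_) (fun q r s => ?_)
    (fun q W hW => ?_) q
  · by_cases hq : D q = ∅
    · rw [show A.δ q a = q from if_pos hq]
      exact hempty q hq _
    · rw [show A.δ q a = _ from if_neg hq]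
      exact hsub _ _
  · by_cases hq : D q = ∅
    · rw [show A.γ q s(r, s) = q from if_pos hq]
      exact hempty q hq _
    · rw [show A.γ q s(r, s) = _ from if_neg hq]
      exact hsub (fork s(r, s)) _
  · have hq : D q ≠ ∅ := fun h => absurd hW.1 (h ▸ Set.notMem_empty W)
    obtain ⟨H, K, hH, hK, hWK, hHK⟩ := hdec _ (hDmem q) W hW
    cases hH with
    | letter a =>
      refine .inl ⟨a, ?_⟩
      rw [show A.δ q a = _ from if_neg hq]
      exact seq_mono subset_rfl (hmax _ _ K hK hHK) hWK
    | fork hM hN =>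
      obtain ⟨r, rfl⟩ := hDsurj hM
      obtain ⟨s, rfl⟩ := hDsurj hN
      refine .inr ⟨r, s, ?_⟩
      rw [show A.γ q s(r, s) = _ from if_neg hq]
      exact seq_mono subset_rfl (hmax (fork s(r, s)) _ K hK hHK) hWK

theorem mainTheorem1 {α : Type*} [Finite α] (e : SRExpr α) :
    ∃ (Q : Type) (_ : Finite Q) (A : PomsetAutomaton α Q),
      (∃ b : Q, A.IsSink b) ∧ A.Accepts e.sem :=
  e.finitelyDecomposable_sem.exists_automaton
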